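/- Let $n$ be a positive integer. Notation. For a positive divisor $r$ of $n$ and a permutation $\sigma$ of $[n]=\{1,\dots,n\}$, let $\mathbf m_\sigma^r\in[n/r]^n$ be the sequence with $\mathbf m_\sigma^r(i)=j$ if and only if $(j-1)r+1\le\sigma(i)\le jr$; these sequences are the $r$-regular multipermutations. For permutations $\sigma,\pi$ of $[n]$ let $\mathrm d_\circ(\sigma,\pi)=n-\ell(\sigma,\pi)$, where $\ell(\sigma,\pi)$ is the length of a longest common subsequence of $(\sigma(1),\dots,\sigma(n))$ and $(\pi(1),\dots,\pi(n))$. The $r$-regular Ulam distance $\mathrm d_\circ(\mathbf m_\sigma^r,\mathbf m_\pi^r)$ is the minimum of $\mathrm d_\circ(\sigma',\pi')$ over all permutations $\sigma',\pi'$ of $[n]$ with $\mathbf m_{\sigma'}^r=\mathbf m_\sigma^r$ and $\mathbf m_{\pi'}^r=\mathbf m_\pi^r$. The $r$-regular Ulam sphere of radius $t$ centered at $\mathbf m_\sigma^r$ is the set $S(\mathbf m_\sigma^r,t)$ of all $r$-regular multipermutations $\mathbf m_\pi^r$ with $\mathrm d_\circ(\mathbf m_\sigma^r,\mathbf m_\pi^r)\le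 t$, and $S(\sigma,t)$ stands for $S(\mathbf m_\sigma^1,t)$. For a partition $\lambda$ of $n$ with largest part $\lambda_1$, let $f^\lambda$ be the number of standard Young tableaux of shape $\lambda$, and let $K_r^\lambda$ be the number of semistandard Young tableaux of shape $\lambda$ (rows weakly increasing, columns strictly increasing) in which each of the numbers $1,\dots,n/r$ occurs exactly $r$ times. Let $e$ be the identity permutation of $[n]$. Theorem. (1) For every positive divisor $r$ of $n$ and every $t\in\{0,1,\dots,n-r\}$, $$|S(\mathbf m_e^r,t)|=\sum_{\lambda\vdash n,\ \lambda_1\ge n-t} f^\lambda\,K_r^\lambda .$$ (2) For every permutation $\sigma$ of $[n]$ and every $t\in\{0,1,\dots,n-1\}$, $$|S(\sigma,t)|=\sum_{\lambda\vdash n,\ \lambda_1\ge n-t} (f^\lambda)^2 .$$ -/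

import Mathlib

namespace UlamSphere

/-- The sequence `m_σ^r` attached to a permutation `σ` of an `n`-element set. The set `[n]` is
modelled by `Fin n = {0, …, n - 1}`, so that `m_σ^r(i) = j` iff
`(j - 1) r + 1 ≤ σ(i) ≤ j r` reads `m_σ^r(i) = ⌊σ(i) / r⌋ + 1` in 0-based values of `σ`.
The entries of the sequence are the numbers `1, …, n / r`. -/
def multiperm {n : ℕ} (r : ℕ) (σ : Equiv.Perm (Fin n)) : Fin n → ℕ :=
  fun i => (σ i : ℕ) / r + 1

/-- The length of a longest common subsequence of two sequences of length `n`. -/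
noncomputable def lcsLength {n : ℕ} (x y : Fin n → ℕ) : ℕ :=
  sSup {k : ℕ | ∃ a b : Fin k → Fin n, StrictMono a ∧ StrictMono b ∧ ∀ l, x (a l) = y (b l)}

/-- The Ulam distance between two permutations, seen as the sequences of their values.
(The subtraction does not truncate: a common subsequence has length at most `n`.) -/
noncomputable def permUlamDist {n : ℕ} (σ π : Equiv.Perm (Fin n)) : ℕ :=
  n - lcsLength (fun i => (σ i : ℕ)) (fun i => (π i : ℕ))

/-- The `r`-regular Ulam distance between two `r`-regular multipermutations `x`, `y`: the minimum
of the Ulam distances between permutations `σ`, `π` that represent `x` and `y`. -/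
noncomputable def ulamDist {n : ℕ} (r : ℕ) (x y : Fin n → ℕ) : ℕ :=
  sInf {d : ℕ | ∃ σ π : Equiv.Perm (Fin n),
    multiperm r σ = x ∧ multiperm r π = y ∧ permUlamDist σ π = d}

/-- The `r`-regular Ulam sphere (a closed ball in the set of `r`-regular multipermutations) of
radius `t` centered at `x`. -/
def sphere {n : ℕ} (r : ℕ) (x : Fin n → ℕ) (t : ℕ) : Set (Fin n → ℕ) :=
  {y | y ∈ Set.range (multiperm (n := n) r) ∧ ulamDist r x y ≤ t}

/-- The Young diagram of a partition: its rows are the parts in weakly decreasing order. -/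
def diagram {n : ℕ} (p : n.Partition) : YoungDiagram :=
  YoungDiagram.ofRowLens (p.parts.sort (· ≥ ·))
    (List.Pairwise.sortedGE (Multiset.pairwise_sort p.parts (· ≥ ·)))

/-- The number of cells of a tableau `T` that contain the number `i`. -/
def numOccurrences {μ : YoungDiagram} (T : SemistandardYoungTableau μ) (i : ℕ) : ℕ :=
  (μ.cells.filter fun c => T c.1 c.2 = i).card

/-- A tableau on a Young diagram is standard if its rows are strictly increasing and each of the
numbers `1, …, n` occurs exactly once, where `n` is the number of cells. (The columns of a
`SemistandardYoungTableau` are strictly increasing.) -/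
def IsStandard {μ : YoungDiagram} (T : SemistandardYoungTableau μ) : Prop :=
  (∀ i j₁ j₂ : ℕ, j₁ < j₂ → (i, j₂) ∈ μ → T i j₁ < T i j₂) ∧
    ∀ i ∈ Finset.Icc 1 μ.card, numOccurrences T i = 1

/-- `f^λ`: the number of standard Young tableaux of shape `λ`. -/
noncomputable def numSYT {n : ℕ} (p : n.Partition) : ℕ :=
  Nat.card {T : SemistandardYoungTableau (diagram p) // IsStandard T}

/-- `K_r^λ`: the number of semistandard Young tableaux of shape `λ` in which each of the numbers
`1, …, n / r` occurs exactly `r` times. -/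
noncomputable def numRegularTableaux {n : ℕ} (r : ℕ) (p : n.Partition) : ℕ :=
  Nat.card {T : SemistandardYoungTableau (diagram p) //
    ∀ i ∈ Finset.Icc 1 (n / r), numOccurrences T i = r}

/-- The set of the partitions `λ` of `n` whose largest part `λ₁` is at least `m`. -/
def partitionsWithFirstGE (n m : ℕ) : Finset n.Partition :=
  Finset.univ.filter fun p => m ≤ p.parts.sup

end UlamSphere

/-!
The theorem is the Robinson–Schensted–Knuth correspondence, combined with Schensted's description of
the first row of the insertion tableau.

A multipermutation `y` is within distance `t` of the sorted word `m_e^r` iff `y` has a weakly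
increasing subsequence of length at least `n - t` (`mem_sphere_one_iff`). A common subsequence of two
representing permutations gives such a subsequence on dividing the values by `r`. Conversely, the
standardization of `y`, a permutation that represents `y` and increases wherever `y` weakly
increases (`IsRegular.exists_multiperm_eq`), has a subsequence in common with the identity for every
weakly increasing subsequence of `y`.

A semistandard tableau with entries in `{1, …, k}` is treated as the chain of the shapes formed by
its entries `≤ v`, for `v = 0, …, k` (`IsChain`, `tableauEquivChain`). In these terms the row
insertion of a letter `x` adds one cell to each of the shapes with `v ≥ x`, and the row of this cell
obeys a local rule in `v` (`bumpRow`): this is the growth diagram form of Schensted's algorithm, in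
which every verification is a comparison of row lengths of two neighbouring shapes. Reverse bumping
says that a tableau and a removable cell of its shape determine the last inserted letter and the
tableau before its insertion (`IsChain.insertLetter_inj`, `IsChain.exists_insertLetter`). By
induction on the length, the words with a given insertion tableau correspond to the standard
tableaux of the same shape (`nonempty_equiv_chains`). The local rule also shows how the first row
grows, so that its length is that of a longest weakly increasing subsequence (`le_insertWord_iff`).
Summing over the shapes gives the first formula (`ncard_sphere_one`).

For `r = 1` the distance is invariant under left multiplication, so that all spheres of the same
radius have the same size, and a tableau with content `(1, …, 1)` is standard.
-/

namespace UlamSphere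

/-! ### Chains of horizontal strips -/

/-- A chain of partitions `∅ = c 0 ⊆ c 1 ⊆ ⋯ ⊆ c k = c (k + 1) = ⋯` in which consecutive partitions
differ by a horizontal strip. Partitions are encoded by their row lengths, indexed from `0`. Such a
chain is the same thing as a semistandard tableau of shape `c k` with entries in `{1, …, k}`:
`c v` is the shape formed by the entries `≤ v`. -/
structure IsChain (k : ℕ) (c : ℕ → ℕ →₀ ℕ) : Prop where
  zero : c 0 = 0
  mono : ∀ v r, c v r ≤ c (v + 1) r
  strip : ∀ v r, c (v + 1) (r + 1) ≤ c v r
  const : ∀ v, k ≤ v → c v = c k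

namespace IsChain

variable {k : ℕ} {c d : ℕ → ℕ →₀ ℕ}

theorem anti (hc : IsChain k c) (v r : ℕ) : c v (r + 1) ≤ c v r := by
  cases v with
  | zero => simp [hc.zero]
  | succ v => exact (hc.strip v r).trans (hc.mono v r)

theorem monotone (hc : IsChain k c) : Monotone c :=
  monotone_nat_of_le_succ fun v => Finsupp.le_def.2 (hc.mono v)

theorem le_top (hc : IsChain k c) (v : ℕ) : c v ≤ c k := by
  rcases le_total v k with h | h
  · exact hc.monotone h
  · exact (hc.const v h).le

end IsChain

/-! ### Row insertion -/

/-- The bumping path of the row insertion of `x` into the tableau of the chain `c`: for `x ≤ v`, the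
row in which the shape of the entries `≤ v` grows by one cell (for `v < x` the value is a mere
placeholder). The growing cell moves to the next row when the entries `v + 1` already occupy its
row, since the first of them is bumped. -/
def bumpRow (x : ℕ) (c : ℕ → ℕ →₀ ℕ) : ℕ → ℕ
  | 0 => 0
  | v + 1 =>
    if v + 1 ≤ x then 0
    else if c v (bumpRow x c v) < c (v + 1) (bumpRow x c v) then bumpRow x c v + 1
    else bumpRow x c v

/-- The chain of the tableau obtained by row insertion of the letter `x` into the tableau of `c`. -/
noncomputable def insertLetter (x : ℕ) (c : ℕ → ℕ →₀ ℕ) (v : ℕ) : ℕ →₀ ℕ :=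
  if x ≤ v then c v + Finsupp.single (bumpRow x c v) 1 else c v

section Insertion

variable {k x y v r : ℕ} {c d : ℕ → ℕ →₀ ℕ}

theorem bumpRow_of_le (h : v ≤ x) : bumpRow x c v = 0 := by
  cases v with
  | zero => rfl
  | succ v => simp [bumpRow, h]

theorem bumpRow_succ (h : x ≤ v) :
    bumpRow x c (v + 1) =
      if c v (bumpRow x c v) < c (v + 1) (bumpRow x c v) then bumpRow x c v + 1
      else bumpRow x c v := by
  rw [bumpRow, if_neg (by omega)]

theorem bumpRow_congr (h : ∀ u ≤ v, c u = d u) : bumpRow x c v = bumpRow x d v := by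
  induction v with
  | zero => rfl
  | succ v ih =>
    simp only [bumpRow]
    rw [ih fun u hu => h u (by omega), h v (by omega), h (v + 1) le_rfl]

theorem insertLetter_congr (h : ∀ u ≤ v, c u = d u) : insertLetter x c v = insertLetter x d v := by
  simp only [insertLetter, h v le_rfl, bumpRow_congr h]

theorem insertLetter_of_lt (h : v < x) : insertLetter x c v = c v := by
  simp [insertLetter, h]

theorem insertLetter_of_le (h : x ≤ v) :
    insertLetter x c v = c v + Finsupp.single (bumpRow x c v) 1 := by
  simp [insertLetter, h]

theorem insertLetter_apply (h : x ≤ v) :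
    insertLetter x c v r = c v r + if bumpRow x c v = r then 1 else 0 := by
  simp [insertLetter, h, Finsupp.single_apply]

theorem degree_insertLetter :
    (insertLetter x c v).degree = (c v).degree + if x ≤ v then 1 else 0 := by
  unfold insertLetter
  split_ifs <;> simp

/-- The bumping path always ends at a cell that can be added to the shape. -/
theorem IsChain.lt_of_bumpRow (hc : IsChain k c) (h : bumpRow x c v = r + 1) :
    c v (r + 1) < c v r := by
  induction v generalizing r with
  | zero => simp [bumpRow] at h
  | succ v ih =>
    have h1 := hc.mono v
    have h2 := hc.strip v r
    have hx : x ≤ v := by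
      by_contra hx
      rw [bumpRow_of_le (by omega)] at h
      omega
    rw [bumpRow_succ hx] at h
    split_ifs at h with hlt
    · obtain rfl : bumpRow x c v = r := by omega
      omega
    · have := ih h
      rw [h] at hlt
      have := h1 r
      omega

theorem IsChain.insertLetter (hc : IsChain k c) (h0 : 0 < x) (hk : x ≤ k) :
    IsChain k (insertLetter x c) where
  zero := by rw [insertLetter_of_lt h0, hc.zero]
  mono v r := by
    have h1 := hc.mono v r
    rcases lt_or_ge v x with h | h
    · rw [insertLetter_of_lt h]
      rcases lt_or_ge (v + 1) x with h' | h'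
      · rwa [insertLetter_of_lt h']
      · rw [insertLetter_apply h']; omega
    · rw [insertLetter_apply h, insertLetter_apply (by omega), bumpRow_succ h]
      generalize bumpRow x c v = j
      split_ifs <;> (try subst j) <;> omega
  strip v r := by
    have h1 := hc.strip v r
    rcases lt_or_ge v x with h | h
    · rw [insertLetter_of_lt h]
      rcases lt_or_ge (v + 1) x with h' | h'
      · rwa [insertLetter_of_lt h']
      · rw [insertLetter_apply h', bumpRow_of_le (by omega), if_neg (by omega)]; omega
    · have h3 := hc.lt_of_bumpRow (x := x) (v := v) (r := r)
      rw [insertLetter_apply h, insertLetter_apply (by omega), bumpRow_succ h]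
      generalize bumpRow x c v = j at *
      split_ifs with h4 h5 h6 h7 h8 <;> (try omega)
      · obtain rfl : j = r + 1 := h8
        have := hc.mono v (r + 1)
        have := h3 rfl
        omega
  const v hv := by
    have hrow : bumpRow x c v = bumpRow x c k := by
      induction v, hv using Nat.le_induction with
      | base => rfl
      | succ v hv ih =>
        rw [bumpRow_succ (by omega), ih, hc.const (v + 1) (by omega), hc.const v hv]
        simp
    rw [insertLetter_of_le (by omega), insertLetter_of_le hk, hrow, hc.const v hv]

/-- Row insertion is undone by reverse bumping: the letter and the previous tableau are determined
by the new tableau together with the row of the new cell. -/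
theorem IsChain.insertLetter_inj (hc : IsChain k c) (hd : IsChain k d) (hx0 : 0 < x) (hxk : x ≤ k)
    (hy0 : 0 < y) (hyk : y ≤ k) (h : UlamSphere.insertLetter x c = UlamSphere.insertLetter y d)
    (hrow : bumpRow x c k = bumpRow y d k) : x = y ∧ c = d := by
  suffices H : ∀ v, x ≤ v → y ≤ v → bumpRow x c v = bumpRow y d v →
      x = y ∧ ∀ u ≤ v, c u = d u by
    obtain ⟨rfl, h2⟩ := H k hxk hyk hrow
    refine ⟨rfl, funext fun v => ?_⟩
    rcases le_total v k with hv | hv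
    · exact h2 v hv
    · rw [hc.const v hv, hd.const v hv, h2 k le_rfl]
  intro v
  induction v with
  | zero => omega
  | succ v ih =>
    intro hx hy hr
    have hv : ∀ u, UlamSphere.insertLetter x c u = UlamSphere.insertLetter y d u := congrFun h
    have hlast : c (v + 1) = d (v + 1) := by
      have := hv (v + 1)
      rw [insertLetter_of_le hx, insertLetter_of_le hy, hr] at this
      exact add_right_cancel this
    suffices H : x = y ∧ ∀ u ≤ v, c u = d u by
      refine ⟨H.1, fun u hu => ?_⟩
      rcases Nat.le_succ_iff.1 hu with hu | rfl
      · exact H.2 u hu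
      · exact hlast
    -- Whether the last step of a bumping path is an insertion, stays in its row or changes rows can
    -- be read off from the new chain.
    have key : ∀ {z : ℕ} {e : ℕ → ℕ →₀ ℕ}, IsChain k e → z ≤ v + 1 →
        (z = v + 1 ∧ bumpRow z e (v + 1) = 0 ∧
          UlamSphere.insertLetter z e v 0 < UlamSphere.insertLetter z e (v + 1) 0) ∨
        (z ≤ v ∧ bumpRow z e (v + 1) = bumpRow z e v ∧
          UlamSphere.insertLetter z e v (bumpRow z e v) =
            UlamSphere.insertLetter z e (v + 1) (bumpRow z e v)) ∨
        (z ≤ v ∧ bumpRow z e (v + 1) = bumpRow z e v + 1 ∧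
          UlamSphere.insertLetter z e v (bumpRow z e v + 1) <
            UlamSphere.insertLetter z e (v + 1) (bumpRow z e v + 1)) := by
      intro z e he hz
      rcases Nat.le_succ_iff.1 hz with hz | rfl
      · right
        have h1 := he.mono v (bumpRow z e v)
        have h2 := he.mono v (bumpRow z e v + 1)
        simp only [insertLetter_apply hz, insertLetter_apply (show z ≤ v + 1 by omega),
          bumpRow_succ hz]
        generalize bumpRow z e v = j at *
        split_ifs <;> omega
      · left
        have h1 := he.mono v 0
        rw [insertLetter_of_lt (by omega), insertLetter_apply le_rfl, bumpRow_of_le le_rfl]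
        simp; omega
    have k1 := key hc hx
    have k2 := key hd hy
    rw [hv v, hv (v + 1)] at k1
    rcases k1 with ⟨e1, e2, e3⟩ | ⟨e1, e2, e3⟩ | ⟨e1, e2, e3⟩ <;>
      rcases k2 with ⟨f1, f2, f3⟩ | ⟨f1, f2, f3⟩ | ⟨f1, f2, f3⟩
    · refine ⟨e1.trans f1.symm, fun u hu => ?_⟩
      have := hv u
      rwa [insertLetter_of_lt (by omega), insertLetter_of_lt (by omega)] at this
    · rw [show bumpRow y d v = 0 by omega] at f3; omega
    · omega
    · rw [show bumpRow x c v = 0 by omega] at e3; omega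
    · exact ih e1 f1 (by omega)
    · rw [show bumpRow x c v = bumpRow y d v + 1 by omega] at e3; omega
    · omega
    · rw [show bumpRow y d v = bumpRow x c v + 1 by omega] at f3; omega
    · exact ih e1 f1 (by omega)

/-- Every removable cell of a tableau is the last cell of a bumping path. -/
theorem IsChain.exists_insertLetter {c' : ℕ → ℕ →₀ ℕ} (hc' : IsChain k c') {i : ℕ}
    (hi : c' k (i + 1) < c' k i) :
    ∃ x c, 0 < x ∧ x ≤ k ∧ IsChain k c ∧ UlamSphere.insertLetter x c = c' ∧ bumpRow x c k = i := by
  suffices H : ∀ k i, c' k (i + 1) < c' k i → ∃ x c, 0 < x ∧ x ≤ k ∧ IsChain k c ∧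
      (∀ v ≤ k, UlamSphere.insertLetter x c v = c' v) ∧ bumpRow x c k = i by
    obtain ⟨x, c, h0, hk, hc, h, hrow⟩ := H k i hi
    refine ⟨x, c, h0, hk, hc, funext fun v => ?_, hrow⟩
    rcases le_total v k with hv | hv
    · exact h v hv
    · rw [(hc.insertLetter h0 hk).const v hv, hc'.const v hv, h k le_rfl]
  clear hi i
  intro k
  induction k with
  | zero => intro i hi; simp [hc'.zero] at hi
  | succ k ih =>
    intro i hi
    -- the shape before the insertion
    obtain ⟨a, ha⟩ : ∃ a : ℕ →₀ ℕ, a + Finsupp.single i 1 = c' (k + 1) :=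
      ⟨_, tsub_add_cancel_of_le (Finsupp.single_le_iff.2 (by omega))⟩
    have ha' : ∀ r, c' (k + 1) r = a r + if i = r then 1 else 0 := fun r => by
      rw [← ha]; simp [Finsupp.single_apply]
    have hanti := hc'.anti k
    have hmono := hc'.mono k
    have hstrip := hc'.strip k
    by_cases hfirst : c' k i < c' (k + 1) i ∧ i = 0
    · -- the bumping path starts here: the last inserted letter is `k + 1`
      obtain ⟨hlt, rfl⟩ := hfirst
      refine ⟨k + 1, fun v => if v ≤ k then c' v else a, by omega, le_rfl, ?_, ?_,
        bumpRow_of_le le_rfl⟩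
      · refine ⟨by simp [hc'.zero], fun v r => ?_, fun v r => ?_, fun v hv => ?_⟩
        · rcases lt_trichotomy v k with h | rfl | h
          · simpa [h.le, Nat.succ_le_of_lt h] using hc'.mono v r
          · have := hmono r
            have := ha' r
            simp only [le_refl, if_true, Nat.not_succ_le_self, if_false]
            split_ifs at this with h0
            · subst h0; omega
            · omega
          · simp [h.not_ge, (Nat.lt_succ_of_lt h).not_ge]
        · rcases lt_trichotomy v k with h | rfl | h
          · simpa [h.le, Nat.succ_le_of_lt h] using hc'.strip v r
          · have := hstrip r
            have := ha' (r + 1)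
            simp only [le_refl, if_true, Nat.not_succ_le_self, if_false]
            simp at this
            omega
          · have := hc'.anti (k + 1) r
            have h1 := ha' r
            have h2 := ha' (r + 1)
            simp only [h.not_ge, (Nat.lt_succ_of_lt h).not_ge, if_false]
            have h3 : 0 = r → c' (k + 1) (r + 1) < c' (k + 1) r := by rintro rfl; exact hi
            split_ifs at h1 h2 <;> omega
        · simp [show ¬ v ≤ k by omega]
      · intro v hv
        rcases Nat.le_succ_iff.1 hv with hv | rfl
        · rw [insertLetter_of_lt (by omega)]; simp [hv]
        · rw [insertLetter_of_le le_rfl, bumpRow_of_le le_rfl]; simpa using ha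
    · -- otherwise the bumping path comes from row `j` of the shape of the entries `≤ k`
      -- (its new cell lies in row `i` if the entries `k + 1` of the new tableau miss that row, and
      -- otherwise it bumps the first of them down from row `i - 1`)
      obtain ⟨j, hj, hcor⟩ : ∃ j, ((j = i ∧ c' k i = c' (k + 1) i) ∨
          (j + 1 = i ∧ c' k i < c' (k + 1) i)) ∧ c' k (j + 1) < c' k j := by
        rcases (hmono i).eq_or_lt with h | h
        · exact ⟨i, Or.inl ⟨rfl, h⟩, by have := hmono (i + 1); omega⟩
        · refine ⟨i - 1, Or.inr ⟨by omega, h⟩, ?_⟩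
          obtain ⟨j, rfl⟩ := Nat.exists_eq_succ_of_ne_zero (show i ≠ 0 by omega)
          have := hstrip j
          simp only [Nat.succ_eq_add_one, add_tsub_cancel_right] at *
          omega
      obtain ⟨x, c, h0, hk, hc, h, hrow⟩ := ih j hcor
      have hck : ∀ r, c' k r = c k r + if j = r then 1 else 0 := fun r => by
        rw [← h k le_rfl, insertLetter_apply hk, hrow]
      have hcongr : ∀ v ≤ k, ∀ u ≤ v, (if u ≤ k then c u else a) = c u := fun v hv u hu => by
        rw [if_pos (by omega)]
      have hrow' : bumpRow x (fun v => if v ≤ k then c v else a) (k + 1) = i := by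
        rw [bumpRow_succ hk, bumpRow_congr (hcongr k le_rfl), hrow]
        have h1 := hck j
        have h2 := ha' j
        simp only [le_refl, if_true, Nat.not_succ_le_self, if_false]
        rcases hj with ⟨rfl, hj⟩ | ⟨rfl, hj⟩
        · simp at h1 h2; rw [if_neg (by omega)]
        · have := hstrip j
          simp at h1 h2; rw [if_pos]
          have := hc'.anti (k + 1) j
          have := hmono j
          omega
      refine ⟨x, fun v => if v ≤ k then c v else a, h0, by omega, ?_, ?_, hrow'⟩
      · refine ⟨by simp [hc.zero], fun v r => ?_, fun v r => ?_, fun v hv => ?_⟩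
        · rcases lt_trichotomy v k with h | rfl | h
          · simpa [h.le, Nat.succ_le_of_lt h] using hc.mono v r
          · have h1 := hck r
            have h2 := ha' r
            have h3 := hmono r
            simp only [le_refl, if_true, Nat.not_succ_le_self, if_false]
            rcases hj with ⟨rfl, hj⟩ | ⟨rfl, hj⟩ <;> split_ifs at h1 h2 <;> (try subst r) <;> omega
          · simp [h.not_ge, (Nat.lt_succ_of_lt h).not_ge]
        · rcases lt_trichotomy v k with h | rfl | h
          · simpa [h.le, Nat.succ_le_of_lt h] using hc.strip v r
          · have h1 := hck r
            have h2 := ha' (r + 1)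
            have h3 := hstrip r
            simp only [le_refl, if_true, Nat.not_succ_le_self, if_false]
            rcases hj with ⟨rfl, hj⟩ | ⟨rfl, hj⟩ <;> split_ifs at h1 h2 <;> (try subst r) <;> omega
          · have := hc'.anti (k + 1) r
            have h1 := ha' r
            have h2 := ha' (r + 1)
            simp only [h.not_ge, (Nat.lt_succ_of_lt h).not_ge, if_false]
            have h3 : i = r → c' (k + 1) (r + 1) < c' (k + 1) r := by rintro rfl; exact hi
            split_ifs at h1 h2 <;> omega
        · simp [show ¬ v ≤ k by omega]
      · intro v hv
        rcases Nat.le_succ_iff.1 hv with hv | rfl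
        · rw [insertLetter_congr (hcongr v hv), h v hv]
        · rw [insertLetter_of_le (by omega), hrow']; simpa using ha

/-- The effect of a row insertion on the first row. -/
theorem IsChain.insertLetter_first_row (hc : IsChain k c) (h : x ≤ v) :
    UlamSphere.insertLetter x c v 0 = max (c v 0) (c x 0 + 1) := by
  suffices H : (bumpRow x c v = 0 ∧ c v 0 = c x 0) ∨ (bumpRow x c v ≠ 0 ∧ c x 0 < c v 0) by
    rw [insertLetter_apply h]
    split_ifs <;> omega
  induction v, h using Nat.le_induction with
  | base => simp [bumpRow_of_le]
  | succ v hv ih =>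
    have := hc.mono v 0
    rw [bumpRow_succ hv]
    rcases ih with ⟨h1, h2⟩ | ⟨h1, h2⟩
    · rw [h1]; split_ifs <;> omega
    · split_ifs <;> omega

end Insertion


/-! ### Chains with regular content -/

/-- The set of the chains with shape `a` and content `(r, r, …, r)`, where `n` is the size of the
shape: `min (v * r) n` of the entries are `≤ v`. -/
def chains (n r k : ℕ) (a : ℕ →₀ ℕ) : Set (ℕ → ℕ →₀ ℕ) :=
  {c | IsChain k c ∧ (∀ v, (c v).degree = min (v * r) n) ∧ c k = a}

/-- Extending a standard chain by one cell. -/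
theorem extend_mem_chains {n i : ℕ} {a b : ℕ →₀ ℕ} {q : ℕ → ℕ →₀ ℕ}
    (hb : b = a + Finsupp.single i 1) (hanti : ∀ r, b (r + 1) ≤ b r) (hi : b (i + 1) < b i)
    (hq : q ∈ chains n 1 n a) :
    (fun v => if v ≤ n then q v else b) ∈ chains (n + 1) 1 (n + 1) b := by
  obtain ⟨hc, hdeg, rfl⟩ := hq
  have happ : ∀ r, b r = q n r + if i = r then 1 else 0 := fun r => by
    simp [hb, Finsupp.single_apply]
  refine ⟨⟨by simp [hc.zero], fun v r => ?_, fun v r => ?_, fun v hv => ?_⟩, fun v => ?_, by simp⟩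
  · rcases lt_trichotomy v n with h | rfl | h
    · simpa [h.le, Nat.succ_le_of_lt h] using hc.mono v r
    · simp [happ]
    · simp [h.not_ge, (Nat.lt_succ_of_lt h).not_ge]
  · rcases lt_trichotomy v n with h | rfl | h
    · simpa [h.le, Nat.succ_le_of_lt h] using hc.strip v r
    · have h1 := hanti r
      have h2 := happ r
      simp only [le_refl, if_true, Nat.not_succ_le_self, if_false]
      by_cases h3 : i = r
      · subst h3; rw [if_pos rfl] at h2; omega
      · rw [if_neg h3] at h2; omega
    · simpa [h.not_ge, (Nat.lt_succ_of_lt h).not_ge] using hanti r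
  · simp [show ¬ v ≤ n by omega]
  · dsimp only
    split_ifs with h
    · rw [hdeg]; omega
    · rw [hb, map_add, hdeg, Finsupp.degree_single]; omega

/-- Removing the last cell of a standard chain. -/
theorem exists_truncate_mem_chains {n : ℕ} {b : ℕ →₀ ℕ} {q : ℕ → ℕ →₀ ℕ}
    (hq : q ∈ chains (n + 1) 1 (n + 1) b) :
    ∃ i a, b = a + Finsupp.single i 1 ∧ b (i + 1) < b i ∧ (fun v => q (min v n)) ∈ chains n 1 n a ∧
      q = fun v => if v ≤ n then q (min v n) else b := by
  obtain ⟨hc, hdeg, rfl⟩ := hq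
  have hle : q n ≤ q (n + 1) := hc.monotone n.le_succ
  have h1 : (q (n + 1) - q n).degree = 1 := by
    have h2 : (q (n + 1) - q n).degree + (q n).degree = (q (n + 1)).degree := by
      rw [← map_add, tsub_add_cancel_of_le hle]
    rw [hdeg, hdeg] at h2
    omega
  obtain ⟨i, hi⟩ : ∃ i, q (n + 1) - q n = Finsupp.single i 1 := by
    have h0 : q (n + 1) - q n ≠ 0 := by
      intro h; rw [h] at h1; simp at h1
    obtain ⟨i, hi⟩ := Finsupp.ne_iff.1 h0
    have hle' : Finsupp.single i 1 ≤ q (n + 1) - q n :=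
      Finsupp.single_le_iff.2 (Nat.one_le_iff_ne_zero.2 hi)
    refine ⟨i, ?_⟩
    have h3 : ((q (n + 1) - q n) - Finsupp.single i 1).degree + 1 = 1 := by
      have := congrArg Finsupp.degree (tsub_add_cancel_of_le hle')
      rwa [map_add, h1, Finsupp.degree_single] at this
    have h4 : (q (n + 1) - q n) - Finsupp.single i 1 = 0 := by
      rw [← Finsupp.degree_eq_zero_iff]; omega
    exact le_antisymm (tsub_eq_zero_iff_le.1 h4) hle'
  have hb : q (n + 1) = q n + Finsupp.single i 1 := by
    rw [← hi, add_tsub_cancel_of_le hle]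
  refine ⟨i, q n, hb, ?_, ⟨⟨by simp [hc.zero], fun v r => ?_, fun v r => ?_, fun v hv => ?_⟩,
    fun v => ?_, by simp⟩, ?_⟩
  · have := hc.strip n i
    have h2 : q (n + 1) i = q n i + 1 := by rw [hb]; simp
    omega
  · exact hc.monotone (by omega) r
  · rcases le_or_gt n v with h | h
    · simpa [h, Nat.le_succ_of_le h] using hc.anti n r
    · simpa [h.le, Nat.succ_le_of_lt h] using hc.strip v r
  · simp [hv]
  · rw [hdeg]; omega
  · funext v
    split_ifs with h
    · rw [min_eq_left h]
    · exact hc.const v (by omega)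

/-! ### The insertion tableau of a word -/

/-- The chain of the tableau that results from inserting the letters of `w` from left to right. -/
noncomputable def insertWord : {n : ℕ} → (Fin n → ℕ) → ℕ → ℕ →₀ ℕ
  | 0, _ => 0
  | n + 1, w => insertLetter (w (Fin.last n)) (insertWord (Fin.init w))

variable {n k : ℕ}

theorem insertWord_snoc (w : Fin n → ℕ) (x : ℕ) :
    insertWord (Fin.snoc (α := fun _ => ℕ) w x) = insertLetter x (insertWord w) := by
  simp [insertWord, Fin.init_snoc]

theorem isChain_insertWord {w : Fin n → ℕ} (hw : ∀ i, w i ∈ Set.Icc 1 k) :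
    IsChain k (insertWord w) := by
  induction n with
  | zero => exact ⟨rfl, fun _ _ => le_rfl, fun _ _ => le_rfl, fun _ _ => rfl⟩
  | succ n ih => exact (ih fun i => hw i.castSucc).insertLetter (hw _).1 (hw _).2

theorem degree_insertWord (w : Fin n → ℕ) (v : ℕ) :
    (insertWord w v).degree = (Finset.univ.filter fun i => w i ≤ v).card := by
  rw [Finset.card_filter]
  induction n with
  | zero => simp [insertWord]
  | succ n ih =>
    rw [Fin.sum_univ_castSucc, insertWord, degree_insertLetter, ih]
    rfl

/-- Schensted's theorem: the first row of the insertion tableau is as long as a longest weakly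
increasing subsequence. The bound `v` on the letters makes the induction work. -/
theorem le_insertWord_iff {w : Fin n → ℕ} (hw : ∀ i, w i ∈ Set.Icc 1 k) (v l : ℕ) :
    l ≤ insertWord w v 0 ↔
      ∃ s : Finset (Fin n), l ≤ s.card ∧ MonotoneOn w s ∧ ∀ i ∈ s, w i ≤ v := by
  induction n generalizing v l with
  | zero =>
    simp only [insertWord, Pi.zero_apply, Finsupp.coe_zero]
    constructor
    · intro h
      exact ⟨∅, by simpa using h, by simp [MonotoneOn], by simp⟩
    · rintro ⟨s, hs, -, -⟩
      simpa [Finset.eq_empty_of_isEmpty s] using hs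
  | succ n ih =>
    have hw' : ∀ i, Fin.init w i ∈ Set.Icc 1 k := fun i => hw i.castSucc
    have hc := isChain_insertWord hw'
    have hlast : ∀ s : Finset (Fin (n + 1)), s.card ≤
        (Finset.univ.filter fun i : Fin n => i.castSucc ∈ s).card +
          if Fin.last n ∈ s then 1 else 0 := by
      intro s
      have h1 : s.card = ∑ i, if i ∈ s then 1 else 0 := by
        rw [← Finset.card_filter]; simp
      rw [h1, Fin.sum_univ_castSucc, Finset.card_filter]
    rw [insertWord]
    constructor
    · intro h
      by_cases hxl : w (Fin.last n) ≤ v ∧ l ≤ insertWord (Fin.init w) (w (Fin.last n)) 0 + 1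
      · obtain ⟨s, hs, hmono, hle⟩ := (ih hw' (w (Fin.last n)) (l - 1)).1 (by omega)
        refine ⟨insert (Fin.last n) (s.map Fin.castSuccEmb), ?_, ?_, ?_⟩
        · rw [Finset.card_insert_of_notMem (by simp [Fin.castSucc_ne_last]), Finset.card_map]
          omega
        · intro i hi j hj hij
          simp only [Finset.coe_insert, Finset.coe_map, Set.mem_insert_iff, Set.mem_image,
            Finset.mem_coe, Fin.coe_castSuccEmb] at hi hj
          rcases hj with rfl | ⟨j, hj, rfl⟩
          · rcases hi with rfl | ⟨i, hi, rfl⟩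
            · exact le_rfl
            · exact hle i hi
          · rcases hi with rfl | ⟨i, hi, rfl⟩
            · exact absurd hij (Fin.castSucc_lt_last j).not_ge
            · exact hmono hi hj (Fin.castSucc_le_castSucc_iff.1 hij)
        · intro i hi
          simp only [Finset.mem_insert, Finset.mem_map, Fin.coe_castSuccEmb] at hi
          rcases hi with rfl | ⟨i, hi, rfl⟩
          · exact hxl.1
          · exact (hle i hi).trans hxl.1
      · have hl : l ≤ insertWord (Fin.init w) v 0 := by
          by_cases hx : w (Fin.last n) ≤ v
          · rw [hc.insertLetter_first_row hx] at h
            have : ¬ l ≤ insertWord (Fin.init w) (w (Fin.last n)) 0 + 1 := fun h' => hxl ⟨hx, h'⟩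
            omega
          · rwa [insertLetter_of_lt (by omega)] at h
        obtain ⟨s, hs, hmono, hle⟩ := (ih hw' v l).1 hl
        refine ⟨s.map Fin.castSuccEmb, by simpa using hs, ?_, ?_⟩
        · intro i hi j hj hij
          simp only [Finset.coe_map, Set.mem_image, Finset.mem_coe, Fin.coe_castSuccEmb] at hi hj
          obtain ⟨i, hi, rfl⟩ := hi
          obtain ⟨j, hj, rfl⟩ := hj
          exact hmono hi hj (Fin.castSucc_le_castSucc_iff.1 hij)
        · intro i hi
          simp only [Finset.mem_map, Fin.coe_castSuccEmb] at hi
          obtain ⟨i, hi, rfl⟩ := hi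
          exact hle i hi
    · rintro ⟨s, hs, hmono, hle⟩
      have hcard := hlast s
      have hmono' : MonotoneOn (Fin.init w)
          (Finset.univ.filter fun i : Fin n => i.castSucc ∈ s : Finset (Fin n)) := by
        intro i hi j hj hij
        exact hmono (by simpa using hi) (by simpa using hj) (Fin.castSucc_le_castSucc_iff.2 hij)
      by_cases hx : Fin.last n ∈ s
      · rw [if_pos hx] at hcard
        have h1 := (ih hw' (w (Fin.last n)) (l - 1)).2
          ⟨Finset.univ.filter fun i : Fin n => i.castSucc ∈ s, by omega, hmono', fun i hi =>
            hmono (by simpa using hi) hx (Fin.le_last _)⟩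
        rw [hc.insertLetter_first_row (hle _ hx)]
        omega
      · rw [if_neg hx] at hcard
        have h1 := (ih hw' v l).2
          ⟨Finset.univ.filter fun i : Fin n => i.castSucc ∈ s, by omega, hmono', fun i hi =>
            hle i.castSucc (by simpa using hi)⟩
        refine h1.trans ?_
        unfold insertLetter
        split_ifs <;> simp

/-- The words with a prescribed insertion tableau correspond to the standard tableaux of the same
shape, their recording tableaux. By `IsChain.insertLetter_inj` and `IsChain.exists_insertLetter`,
both sides split in the same way according to the position of the last added cell. -/
theorem nonempty_equiv_chains {c : ℕ → ℕ →₀ ℕ} (hc : IsChain k c) (hn : (c k).degree = n) :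
    Nonempty ({w : Fin n → ℕ // (∀ i, w i ∈ Set.Icc 1 k) ∧ insertWord w = c} ≃
      chains n 1 n (c k)) := by
  induction n generalizing c with
  | zero =>
    have hck : c k = 0 := (Finsupp.degree_eq_zero_iff _).1 hn
    have hc0 : c = 0 := funext fun v => le_antisymm ((hc.le_top v).trans hck.le) (zero_le)
    have h1 : Nonempty (Unique {w : Fin 0 → ℕ // (∀ i, w i ∈ Set.Icc 1 k) ∧ insertWord w = c}) :=
      ⟨⟨⟨⟨Fin.elim0, fun i => i.elim0, hc0.symm⟩⟩, fun w => Subtype.ext (funext fun i => i.elim0)⟩⟩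
    have h2 : Nonempty (Unique (chains 0 1 0 (c k))) := by
      refine ⟨⟨⟨⟨0, ⟨rfl, fun _ _ => le_rfl, fun _ _ => le_rfl, fun _ _ => rfl⟩, by simp, ?_⟩⟩,
        fun q => Subtype.ext (funext fun v => ?_)⟩⟩
      · exact hck.symm
      · have := q.2.2.1 v
        exact (Finsupp.degree_eq_zero_iff _).1 (by simpa using this)
    obtain ⟨h1⟩ := h1
    obtain ⟨h2⟩ := h2
    exact ⟨Equiv.ofUnique _ _⟩
  | succ n ih =>
    let I := {i // c k (i + 1) < c k i}
    choose x d hx0 hxk hd hins hrow using fun i : I => hc.exists_insertLetter i.2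
    have hck : ∀ i : I, c k = d i k + Finsupp.single (i : ℕ) 1 := fun i => by
      rw [← hrow i, ← insertLetter_of_le (hxk i), hins i]
    have hdeg : ∀ i : I, (d i k).degree = n := fun i => by
      rw [hck i, map_add, Finsupp.degree_single] at hn
      omega
    have e := fun i : I => Classical.choice (ih (hd i) (hdeg i))
    let f : (Σ i : I, {w : Fin n → ℕ // (∀ j, w j ∈ Set.Icc 1 k) ∧ insertWord w = d i}) →
        {w : Fin (n + 1) → ℕ // (∀ i, w i ∈ Set.Icc 1 k) ∧ insertWord w = c} := fun p =>
      ⟨Fin.snoc (α := fun _ => ℕ) p.2.1 (x p.1), by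
        refine ⟨fun j => ?_, by rw [insertWord_snoc, p.2.2.2, hins]⟩
        refine Fin.lastCases ?_ (fun j => ?_) j
        · simpa using ⟨hx0 p.1, hxk p.1⟩
        · simpa using p.2.2.1 j⟩
    have hf : Function.Bijective f := by
      constructor
      · rintro ⟨i, w, hw⟩ ⟨j, w', hw'⟩ h
        have h' : Fin.snoc (α := fun _ => ℕ) w (x i) = Fin.snoc (α := fun _ => ℕ) w' (x j) :=
          congrArg Subtype.val h
        obtain ⟨rfl, hx⟩ := Fin.snoc_inj.1 h'
        obtain rfl : i = j := Subtype.ext <| by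
          rw [← hrow i, ← hrow j, hx, ← hw.2, ← hw'.2]
        rfl
      · rintro ⟨w, hw, hwc⟩
        have hd' := isChain_insertWord (k := k) (w := Fin.init w) fun j => hw j.castSucc
        rw [insertWord] at hwc
        have hlast := insertLetter_of_le (c := insertWord (Fin.init w)) (hw (Fin.last n)).2
        rw [hwc] at hlast
        let i : I := ⟨bumpRow (w (Fin.last n)) (insertWord (Fin.init w)) k, by
          rw [hlast]
          have := hd'.anti k (bumpRow (w (Fin.last n)) (insertWord (Fin.init w)) k)
          simp
          omega⟩
        obtain ⟨h1, h2⟩ := hd'.insertLetter_inj (hd i) (hw _).1 (hw _).2 (hx0 i) (hxk i)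
          (hwc.trans (hins i).symm) (hrow i).symm
        refine ⟨⟨i, Fin.init w, fun j => hw j.castSucc, h2⟩, Subtype.ext ?_⟩
        simp only [f, ← h1]
        exact Fin.snoc_init_self w
    let g : (Σ i : I, chains n 1 n (d i k)) → chains (n + 1) 1 (n + 1) (c k) := fun p =>
      ⟨fun v => if v ≤ n then p.2.1 v else c k,
        extend_mem_chains (hck p.1) (hc.anti k) p.1.2 p.2.2⟩
    have hg : Function.Bijective g := by
      constructor
      · rintro ⟨i, q, hq⟩ ⟨j, q', hq'⟩ h
        have h' : ∀ v ≤ n, q v = q' v := fun v hv => by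
          have := congrFun (congrArg Subtype.val h) v
          simpa [g, hv] using this
        have hqq : q = q' := funext fun v => by
          rcases le_total v n with hv | hv
          · exact h' v hv
          · rw [hq.1.const v hv, hq'.1.const v hv, h' n le_rfl]
        subst hqq
        have hij : d i k = d j k := hq.2.2.symm.trans hq'.2.2
        obtain rfl : i = j := Subtype.ext <| by
          have h4 := (hck i).symm.trans (hck j)
          rw [hij] at h4
          exact Finsupp.single_left_injective one_ne_zero (add_left_cancel h4)
        rfl
      · rintro ⟨q, hq⟩
        obtain ⟨i, a, ha, hi, hmem, hqe⟩ := exists_truncate_mem_chains hq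
        have hda : d ⟨i, hi⟩ k = a := add_right_cancel ((hck ⟨i, hi⟩).symm.trans ha)
        exact ⟨⟨⟨i, hi⟩, _, hda ▸ hmem⟩, Subtype.ext hqe.symm⟩
    exact ⟨(Equiv.ofBijective f hf).symm.trans
      ((Equiv.sigmaCongrRight e).trans (Equiv.ofBijective g hg))⟩


/-! ### Young diagrams and partitions -/

/-- The row lengths of a Young diagram as a finitely supported function. -/
noncomputable def rowShape (μ : YoungDiagram) : ℕ →₀ ℕ :=
  Finsupp.onFinset (Finset.range (μ.colLen 0)) μ.rowLen fun i hi => by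
    rw [Finset.mem_range, ← YoungDiagram.mem_iff_lt_colLen, YoungDiagram.mem_iff_lt_rowLen]
    omega

theorem lt_rowShape {μ : YoungDiagram} {i j : ℕ} : j < rowShape μ i ↔ (i, j) ∈ μ :=
  YoungDiagram.mem_iff_lt_rowLen.symm

theorem rowShape_injective : Function.Injective rowShape := fun μ ν h => by
  ext ⟨i, j⟩
  rw [YoungDiagram.mem_cells, YoungDiagram.mem_cells, ← lt_rowShape, ← lt_rowShape, h]

theorem degree_rowShape (μ : YoungDiagram) : (rowShape μ).degree = μ.card := by
  have hsupp : ∀ c ∈ μ.cells, c.1 ∈ (rowShape μ).support := by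
    rintro ⟨i, j⟩ hc
    have := lt_rowShape.2 (YoungDiagram.mem_cells _ |>.1 hc)
    exact Finsupp.mem_support_iff.2 (Nat.ne_zero_of_lt this)
  rw [Finsupp.degree_apply, YoungDiagram.card, Finset.card_eq_sum_card_fiberwise hsupp]
  exact Finset.sum_congr rfl fun i _ => YoungDiagram.rowLen_eq_card μ

theorem exists_rowShape_eq {a : ℕ →₀ ℕ} (ha : ∀ i, a (i + 1) ≤ a i) : ∃ μ, rowShape μ = a := by
  have hmem : ∀ c : ℕ × ℕ,
      c ∈ a.support.biUnion (fun i => {i} ×ˢ Finset.range (a i)) ↔ c.2 < a c.1 := by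
    rintro ⟨i, j⟩
    simp only [Finset.mem_biUnion, Finsupp.mem_support_iff, Finset.mem_product,
      Finset.mem_singleton, Finset.mem_range]
    constructor
    · rintro ⟨_, -, rfl, h⟩
      exact h
    · intro h
      exact ⟨i, by omega, rfl, h⟩
  let μ : YoungDiagram := ⟨a.support.biUnion fun i => {i} ×ˢ Finset.range (a i), by
    rintro ⟨i, j⟩ ⟨i', j'⟩ ⟨hi : i' ≤ i, hj : j' ≤ j⟩ h
    rw [Finset.mem_coe, hmem] at h ⊢
    have := antitone_nat_of_succ_le ha hi
    dsimp only at *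
    omega⟩
  refine ⟨μ, Finsupp.ext fun i => eq_of_forall_lt_iff fun j => ?_⟩
  rw [lt_rowShape, ← YoungDiagram.mem_cells]
  exact hmem (i, j)

theorem rowLens_diagram (p : n.Partition) : (diagram p).rowLens = p.parts.sort (· ≥ ·) :=
  YoungDiagram.rowLens_ofRowLens_eq_self fun _ hx => p.parts_pos ((Multiset.mem_sort _).1 hx)

theorem sum_rowLens (μ : YoungDiagram) : μ.rowLens.sum = μ.card := by
  rw [← degree_rowShape, Finsupp.degree_apply, YoungDiagram.rowLens]
  rw [Finset.sum_subset (s₁ := (rowShape μ).support) (s₂ := Finset.range (μ.colLen 0))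
    Finsupp.support_onFinset_subset
    (fun i _ hi => by simpa using hi)]
  rfl

theorem card_diagram (p : n.Partition) : (diagram p).card = n := by
  rw [← sum_rowLens, rowLens_diagram, ← Multiset.sum_coe, Multiset.sort_eq, p.parts_sum]

theorem diagram_injective : Function.Injective (diagram (n := n)) := fun p q h => by
  have h' := congrArg (fun l : List ℕ => (l : Multiset ℕ)) (congrArg YoungDiagram.rowLens h)
  simp only [rowLens_diagram, Multiset.sort_eq] at h'
  exact Nat.Partition.ext h'

theorem exists_diagram_eq {μ : YoungDiagram} (hμ : μ.card = n) :
    ∃ p : n.Partition, diagram p = μ := by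
  refine ⟨⟨μ.rowLens, fun {i} hi => μ.pos_of_mem_rowLens i (by simpa using hi), by
    rw [Multiset.sum_coe, sum_rowLens, hμ]⟩, ?_⟩
  apply YoungDiagram.equivListRowLens.injective
  refine Subtype.ext ?_
  simp only [YoungDiagram.equivListRowLens_apply_coe, rowLens_diagram]
  exact List.Perm.eq_of_pairwise' (Multiset.pairwise_sort _ _) μ.rowLens_sorted.pairwise
    (Multiset.coe_eq_coe.1 (Multiset.sort_eq _ _))

theorem sup_parts (p : n.Partition) : p.parts.sup = rowShape (diagram p) 0 := by
  have hparts : p.parts = ((diagram p).rowLens : Multiset ℕ) := by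
    rw [rowLens_diagram, Multiset.sort_eq]
  apply le_antisymm
  · refine Multiset.sup_le.2 fun b hb => ?_
    rw [hparts, Multiset.mem_coe, YoungDiagram.rowLens, List.mem_map] at hb
    obtain ⟨i, -, rfl⟩ := hb
    exact YoungDiagram.rowLen_anti _ _ _ (Nat.zero_le i)
  · rcases Nat.eq_zero_or_pos (rowShape (diagram p) 0) with h | h
    · omega
    · refine Multiset.le_sup ?_
      rw [hparts, Multiset.mem_coe, YoungDiagram.rowLens, List.mem_map]
      refine ⟨0, ?_, rfl⟩
      rw [List.mem_range, ← YoungDiagram.mem_iff_lt_colLen]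
      exact lt_rowShape.1 h

/-! ### Tableaux as chains -/

/-- The cells of a tableau with an entry `≤ v` form a Young diagram. -/
def entriesLE {μ : YoungDiagram} (T : SemistandardYoungTableau μ) (v : ℕ) : YoungDiagram where
  cells := μ.cells.filter fun c => T c.1 c.2 ≤ v
  isLowerSet := by
    rintro ⟨i, j⟩ ⟨i', j'⟩ ⟨hi : i' ≤ i, hj : j' ≤ j⟩ h
    simp only [Finset.coe_filter, YoungDiagram.mem_cells, Set.mem_ofPred_eq] at h ⊢
    have h1 := μ.up_left_mem le_rfl hj h.1
    exact ⟨μ.up_left_mem hi hj h.1,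
      (T.col_weak hi h1).trans ((T.row_weak_of_le hj h.1).trans h.2)⟩

theorem mem_entriesLE {μ : YoungDiagram} {T : SemistandardYoungTableau μ} {v i j : ℕ} :
    (i, j) ∈ entriesLE T v ↔ (i, j) ∈ μ ∧ T i j ≤ v := by
  rw [← YoungDiagram.mem_cells]
  simp [entriesLE]

theorem isChain_entriesLE {μ : YoungDiagram} {T : SemistandardYoungTableau μ} {k : ℕ}
    (hT : ∀ i j, (i, j) ∈ μ → T i j ∈ Set.Icc 1 k) :
    IsChain k fun v => rowShape (entriesLE T v) where
  zero := by
    refine Finsupp.ext fun i => eq_of_forall_lt_iff fun j => ?_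
    rw [lt_rowShape, mem_entriesLE]
    simpa using fun h => Nat.one_le_iff_ne_zero.1 (hT i j h).1
  mono v r := by
    refine le_of_forall_lt fun j hj => ?_
    rw [lt_rowShape, mem_entriesLE] at hj ⊢
    exact ⟨hj.1, hj.2.trans v.le_succ⟩
  strip v r := by
    refine le_of_forall_lt fun j hj => ?_
    rw [lt_rowShape, mem_entriesLE] at hj ⊢
    have := T.col_strict (Nat.lt_add_one r) hj.1
    exact ⟨μ.up_left_mem r.le_succ le_rfl hj.1, by omega⟩
  const v hv := by
    refine Finsupp.ext fun i => eq_of_forall_lt_iff fun j => ?_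
    rw [lt_rowShape, lt_rowShape, mem_entriesLE, mem_entriesLE]
    exact and_congr_right fun h => by have := (hT i j h).2; constructor <;> omega

theorem IsChain.sInf_le_iff {μ : YoungDiagram} {k : ℕ} {c : ℕ → ℕ →₀ ℕ} (hc : IsChain k c)
    (hμ : c k = rowShape μ) {i j v : ℕ} :
    (i, j) ∈ μ ∧ sInf {u | j < c u i} ≤ v ↔ j < c v i := by
  constructor
  · rintro ⟨h1, h2⟩
    have h3 : j < c (sInf {u | j < c u i}) i :=
      Nat.sInf_mem (s := {u | j < c u i}) ⟨k, by simpa [hμ] using lt_rowShape.2 h1⟩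
    exact h3.trans_le (hc.monotone h2 i)
  · intro h
    exact ⟨lt_rowShape.1 (h.trans_le (hμ ▸ hc.le_top v i)), Nat.sInf_le h⟩

/-- The tableau of a chain: the entry of a cell is the step at which it is added. (Outside of the
diagram it is `sInf ∅ = 0`, as required.) -/
noncomputable def IsChain.tableau {μ : YoungDiagram} {k : ℕ} {c : ℕ → ℕ →₀ ℕ} (hc : IsChain k c)
    (hμ : c k = rowShape μ) : SemistandardYoungTableau μ where
  entry i j := sInf {v | j < c v i}
  row_weak' {i j₁ j₂} hj h :=
    ((hc.sInf_le_iff hμ).2 (hj.trans ((hc.sInf_le_iff hμ).1 ⟨h, le_rfl⟩))).2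
  col_strict' {i₁ i₂ j} hi h := by
    have h1 := (hc.sInf_le_iff hμ).1 ⟨h, le_rfl⟩
    generalize sInf {v | j < c v i₂} = v at h1 ⊢
    obtain ⟨i₂, rfl⟩ := Nat.exists_eq_succ_of_ne_zero (show i₂ ≠ 0 by omega)
    cases v with
    | zero => simp [hc.zero] at h1
    | succ v =>
      have h2 := hc.strip v i₂
      have h3 := antitone_nat_of_succ_le (hc.anti v) (Nat.lt_succ_iff.1 hi)
      exact Nat.lt_succ_iff.2 ((hc.sInf_le_iff hμ).2 (by simp at *; omega)).2
  zeros' {i j} h := by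
    have : {v | j < c v i} = ∅ :=
      Set.eq_empty_of_forall_notMem fun v hv => h ((hc.sInf_le_iff hμ).2 hv).1
    simp [this]

theorem IsChain.tableau_apply {μ : YoungDiagram} {k : ℕ} {c : ℕ → ℕ →₀ ℕ} (hc : IsChain k c)
    (hμ : c k = rowShape μ) (i j : ℕ) : hc.tableau hμ i j = sInf {v | j < c v i} := rfl

/-- Semistandard tableaux with entries in `{1, …, k}` are chains of horizontal strips. -/
noncomputable def tableauEquivChain (μ : YoungDiagram) (k : ℕ) :
    {T : SemistandardYoungTableau μ // ∀ i j, (i, j) ∈ μ → T i j ∈ Set.Icc 1 k} ≃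
      {c : ℕ → ℕ →₀ ℕ // IsChain k c ∧ c k = rowShape μ} where
  toFun T := ⟨fun v => rowShape (entriesLE T.1 v), isChain_entriesLE T.2, by
    refine Finsupp.ext fun i => eq_of_forall_lt_iff fun j => ?_
    rw [lt_rowShape, lt_rowShape, mem_entriesLE]
    exact and_iff_left_of_imp fun h => (T.2 i j h).2⟩
  invFun c := ⟨c.2.1.tableau c.2.2, fun i j h => by
    rw [IsChain.tableau_apply]
    constructor
    · by_contra h0
      have := (c.2.1.sInf_le_iff c.2.2).1 ⟨h, Nat.lt_one_iff.1 (not_le.1 h0) |>.le⟩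
      simp [c.2.1.zero] at this
    · exact Nat.sInf_le (by simpa [c.2.2] using lt_rowShape.2 h)⟩
  left_inv T := by
    refine Subtype.ext (SemistandardYoungTableau.ext fun i j => ?_)
    simp only [IsChain.tableau_apply, lt_rowShape, mem_entriesLE]
    by_cases h : (i, j) ∈ μ
    · simp only [h, true_and]
      exact csInf_Ici
    · simp [h, T.1.zeros h]
  right_inv c := by
    refine Subtype.ext (funext fun v => Finsupp.ext fun i => eq_of_forall_lt_iff fun j => ?_)
    rw [lt_rowShape, mem_entriesLE, IsChain.tableau_apply]
    exact c.2.1.sInf_le_iff c.2.2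

theorem sum_numOccurrences {μ : YoungDiagram} (T : SemistandardYoungTableau μ) (v : ℕ) :
    ∑ i ∈ Finset.Icc 1 v, numOccurrences T i =
      (μ.cells.filter fun c => T c.1 c.2 ∈ Finset.Icc 1 v).card := by
  rw [Finset.card_eq_sum_card_fiberwise (f := fun c : ℕ × ℕ => T c.1 c.2) (t := Finset.Icc 1 v)
    (fun c hc => by simpa using (Finset.mem_filter.1 hc).2)]
  refine Finset.sum_congr rfl fun i hi => ?_
  rw [numOccurrences, Finset.filter_filter]
  congr 1
  refine Finset.filter_congr fun c _ => ?_
  constructor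
  · rintro rfl; exact ⟨hi, rfl⟩
  · exact fun h => h.2

theorem mem_Icc_of_regular {μ : YoungDiagram} {T : SemistandardYoungTableau μ} {r k : ℕ}
    (hμ : k * r = μ.card) (hT : ∀ i ∈ Finset.Icc 1 k, numOccurrences T i = r) (i j : ℕ)
    (h : (i, j) ∈ μ) : T i j ∈ Set.Icc 1 k := by
  have h1 := sum_numOccurrences T k
  rw [Finset.sum_congr rfl hT, Finset.sum_const, Nat.card_Icc, smul_eq_mul, Nat.add_sub_cancel,
    hμ] at h1
  have h2 := Finset.filter_card_eq h1.symm (i, j) (YoungDiagram.mem_cells _ |>.2 h)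
  simpa using h2

theorem card_entriesLE {μ : YoungDiagram} {T : SemistandardYoungTableau μ} {k : ℕ}
    (hT : ∀ i j, (i, j) ∈ μ → T i j ∈ Set.Icc 1 k) (v : ℕ) :
    (entriesLE T v).card = ∑ i ∈ Finset.Icc 1 v, numOccurrences T i := by
  rw [sum_numOccurrences]
  refine congrArg Finset.card (Finset.filter_congr ?_)
  rintro ⟨i, j⟩ hc
  have := (hT i j hc).1
  simp only [Finset.mem_Icc]
  omega

/-- For a tableau with entries in `{1, …, k}`, regular content is a condition on the sizes of the
shapes in its chain. -/
theorem regular_iff {μ : YoungDiagram} {T : SemistandardYoungTableau μ} {r k : ℕ}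
    (hμ : k * r = μ.card) (hT : ∀ i j, (i, j) ∈ μ → T i j ∈ Set.Icc 1 k) :
    (∀ i ∈ Finset.Icc 1 k, numOccurrences T i = r) ↔
      ∀ v, (rowShape (entriesLE T v)).degree = min (v * r) μ.card := by
  constructor
  · intro h v
    have hle : ∀ v ≤ k, (rowShape (entriesLE T v)).degree = v * r := fun v hv => by
      rw [degree_rowShape, card_entriesLE hT, Finset.sum_congr rfl fun i hi => h i (by
        simp only [Finset.mem_Icc] at hi ⊢; omega)]
      simp
    rcases le_total v k with hv | hv
    · rw [hle v hv, min_eq_left]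
      exact hμ ▸ Nat.mul_le_mul_right r hv
    · rw [(isChain_entriesLE hT).const v hv, hle k le_rfl, hμ, min_eq_right]
      exact hμ ▸ Nat.mul_le_mul_right r hv
  · intro h i hi
    rw [Finset.mem_Icc] at hi
    obtain ⟨i, rfl⟩ := Nat.exists_eq_succ_of_ne_zero (show i ≠ 0 by omega)
    have h1 := h i
    have h2 := h (i + 1)
    have h3 : (i + 1) * r ≤ k * r := Nat.mul_le_mul_right r hi.2
    rw [degree_rowShape, card_entriesLE hT] at h1 h2
    rw [Finset.sum_Icc_succ_top (by omega), h1, ← hμ, min_eq_left h3, min_eq_left (by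
      rw [Nat.succ_mul] at h3; omega), Nat.succ_mul] at h2
    simpa using h2

theorem numRegularTableaux_eq {r : ℕ} (hr : r ∣ n) (p : n.Partition) :
    numRegularTableaux r p = Nat.card (chains n r (n / r) (rowShape (diagram p))) := by
  have hμ : n / r * r = (diagram p).card := by rw [Nat.div_mul_cancel hr, card_diagram]
  refine Nat.card_congr ?_
  refine (Equiv.subtypeSubtypeEquivSubtype (mem_Icc_of_regular hμ)).symm.trans ?_
  refine ((tableauEquivChain (diagram p) (n / r)).subtypeEquiv
    (q := fun c => ∀ v, (c.1 v).degree = min (v * r) n) fun T => ?_).trans ?_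
  · rw [regular_iff hμ T.2, card_diagram]
    rfl
  · refine (Equiv.subtypeSubtypeEquivSubtypeInter
      (fun c => IsChain (n / r) c ∧ c (n / r) = rowShape (diagram p))
      fun c => ∀ v, (c v).degree = min (v * r) n).trans ?_
    exact Equiv.subtypeEquivRight fun c =>
      ⟨fun h => ⟨h.1.1, h.2, h.1.2⟩, fun h => ⟨⟨h.1, h.2.2⟩, h.2.1⟩⟩

theorem isStandard_iff {μ : YoungDiagram} {T : SemistandardYoungTableau μ} :
    IsStandard T ↔ ∀ i ∈ Finset.Icc 1 μ.card, numOccurrences T i = 1 := by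
  refine and_iff_right_of_imp fun h i j₁ j₂ hj hmem => ?_
  refine lt_of_le_of_ne (T.row_weak hj hmem) fun heq => ?_
  have h1 := h (T i j₂) (by simpa using mem_Icc_of_regular (mul_one _) h i j₂ hmem)
  obtain ⟨c, hc⟩ := Finset.card_eq_one.1 h1
  have h2 : ∀ j, (i, j) ∈ μ → T i j = T i j₂ → (i, j) = c := fun j hj' he => by
    rw [← Finset.mem_singleton, ← hc]
    simp [hj', he]
  have h3 := (h2 j₁ (μ.up_left_mem le_rfl hj.le hmem) heq).trans (h2 j₂ hmem rfl).symm
  simp only [Prod.mk.injEq] at h3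
  omega

theorem numSYT_eq_numRegularTableaux (p : n.Partition) : numSYT p = numRegularTableaux 1 p := by
  refine Nat.card_congr (Equiv.subtypeEquivRight fun T => ?_)
  rw [isStandard_iff, card_diagram, Nat.div_one]


/-! ### Regular multipermutations and their distances -/

variable {r : ℕ}

/-- A word of length `n` is regular if it contains the letters `1, …, n / r` exactly `r` times each
(when `r` divides `n`): the number of its letters that are `≤ v` is `min (v * r) n`. -/
def IsRegular (r : ℕ) (y : Fin n → ℕ) : Prop :=
  ∀ v, (Finset.univ.filter fun i => y i ≤ v).card = min (v * r) n

theorem div_add_one_le_iff (hr : 0 < r) {j v : ℕ} : j / r + 1 ≤ v ↔ j < v * r := by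
  rw [Nat.succ_le_iff, Nat.div_lt_iff_lt_mul hr]

theorem isRegular_multiperm (hr : 0 < r) (σ : Equiv.Perm (Fin n)) :
    IsRegular r (multiperm r σ) := fun v => by
  have h1 : (Finset.univ.filter fun i => multiperm r σ i ≤ v).card =
      (Finset.univ.filter fun j : Fin n => (j : ℕ) < v * r).card :=
    Finset.card_equiv σ fun i => by simp [multiperm, div_add_one_le_iff hr]
  rw [h1, Fin.card_filter_val_lt, min_comm]

/-- The standardization of a regular word: a permutation that represents it and that is increasing
wherever the word is weakly increasing. -/
theorem IsRegular.exists_multiperm_eq (hr : 0 < r) {y : Fin n → ℕ} (hy : IsRegular r y) :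
    ∃ π : Equiv.Perm (Fin n), multiperm r π = y ∧ ∀ i j, i < j → y i ≤ y j → π i < π j := by
  obtain ⟨hmono, hstable⟩ := Tuple.eq_sort_iff.1 (rfl : Tuple.sort y = Tuple.sort y)
  set s := Tuple.sort y
  have hs : ∀ j, y (s j) = (j : ℕ) / r + 1 := fun j => by
    refine eq_of_forall_ge_iff fun v => ?_
    have h1 := Tuple.lt_card_le_iff_apply_le_of_monotone (j := j) (a := v) hmono
    have h2 : (Finset.univ.filter fun i => (y ∘ s) i ≤ v).card = min (v * r) n := by
      rw [← hy v]
      exact Finset.card_equiv s fun i => by simp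
    rw [h2] at h1
    rw [div_add_one_le_iff hr]
    have := j.2
    simp only [Function.comp_apply] at h1
    rw [← h1]
    omega
  refine ⟨s.symm, funext fun i => ?_, fun i j hij hle => ?_⟩
  · have := hs (s.symm i)
    rw [Equiv.apply_symm_apply] at this
    exact this.symm
  · by_contra! h
    have h1 := hmono h
    simp only [Function.comp_apply, Equiv.apply_symm_apply] at h1
    rcases h.eq_or_lt with h | h
    · exact hij.ne' (s.symm.injective h)
    · have := hstable _ _ h (by
        rw [Equiv.apply_symm_apply, Equiv.apply_symm_apply]; exact le_antisymm h1 hle)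
      simp only [Equiv.apply_symm_apply] at this
      exact hij.not_gt this

theorem IsRegular.mem_Icc (hr : r ∣ n) {y : Fin n → ℕ} (hy : IsRegular r y) (i : Fin n) :
    y i ∈ Set.Icc 1 (n / r) := by
  constructor
  · by_contra h
    have h0 := hy 0
    rw [zero_mul, Nat.zero_min, Finset.card_eq_zero] at h0
    exact Finset.notMem_empty i (h0 ▸ Finset.mem_filter.2 ⟨Finset.mem_univ i, by omega⟩)
  · have h1 := hy (n / r)
    rw [Nat.div_mul_cancel hr, min_self] at h1
    exact Finset.filter_card_eq (h1.trans (by simp)) i (Finset.mem_univ i)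

theorem le_lcsLength_iff {x y : Fin n → ℕ} {m : ℕ} :
    m ≤ lcsLength x y ↔ ∃ k, m ≤ k ∧
      ∃ a b : Fin k → Fin n, StrictMono a ∧ StrictMono b ∧ ∀ l, x (a l) = y (b l) := by
  have hbdd : BddAbove {k : ℕ | ∃ a b : Fin k → Fin n,
      StrictMono a ∧ StrictMono b ∧ ∀ l, x (a l) = y (b l)} := by
    refine ⟨n, ?_⟩
    rintro k ⟨a, -, ha, -⟩
    simpa using Fintype.card_le_of_injective a ha.injective
  constructor
  · intro h
    exact ⟨_, h, Nat.sSup_mem (s := {k : ℕ | ∃ a b : Fin k → Fin n,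
      StrictMono a ∧ StrictMono b ∧ ∀ l, x (a l) = y (b l)})
        ⟨0, Fin.elim0, Fin.elim0, fun i => i.elim0, fun i => i.elim0,
      fun i => i.elim0⟩ hbdd⟩
  · rintro ⟨k, hk, h⟩
    exact hk.trans (le_csSup hbdd h)

theorem ulamDist_le_iff {σ π : Equiv.Perm (Fin n)} {t : ℕ} :
    ulamDist r (multiperm r σ) (multiperm r π) ≤ t ↔ ∃ σ' π' : Equiv.Perm (Fin n),
      multiperm r σ' = multiperm r σ ∧ multiperm r π' = multiperm r π ∧ permUlamDist σ' π' ≤ t := by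
  constructor
  · intro h
    obtain ⟨σ', π', h1, h2, h3⟩ := Nat.sInf_mem (s := {d : ℕ | ∃ σ' π' : Equiv.Perm (Fin n),
      multiperm r σ' = multiperm r σ ∧ multiperm r π' = multiperm r π ∧
        permUlamDist σ' π' = d}) ⟨_, σ, π, rfl, rfl, rfl⟩
    exact ⟨σ', π', h1, h2, h3.trans_le h⟩
  · rintro ⟨σ', π', h1, h2, h3⟩
    refine le_trans (Nat.sInf_le ?_) h3
    exact ⟨σ', π', h1, h2, rfl⟩

/-- The sphere around the sorted word consists of the regular words whose insertion tableau has a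
long first row. -/
theorem mem_sphere_one_iff (hr : 0 < r) (hrn : r ∣ n) {y : Fin n → ℕ} {t : ℕ} :
    y ∈ sphere r (multiperm r 1) t ↔ IsRegular r y ∧ n - t ≤ insertWord y (n / r) 0 := by
  constructor
  · rintro ⟨⟨π₀, rfl⟩, hd⟩
    have hreg := isRegular_multiperm hr π₀
    refine ⟨hreg, ?_⟩
    obtain ⟨σ, π, hσ, hπ, hd⟩ := ulamDist_le_iff.1 hd
    have hlcs : n - t ≤ lcsLength (fun i => (σ i : ℕ)) (fun i => (π i : ℕ)) := by
      unfold permUlamDist at hd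
      omega
    obtain ⟨l, hl, a, b, ha, hb, hab⟩ := le_lcsLength_iff.1 hlcs
    refine (le_insertWord_iff (hreg.mem_Icc hrn) _ _).2
      ⟨Finset.univ.image b, ?_, ?_, fun i _ => (hreg.mem_Icc hrn i).2⟩
    · rwa [Finset.card_image_of_injective _ hb.injective, Finset.card_univ, Fintype.card_fin]
    · have key : ∀ l, multiperm r π₀ (b l) = (a l : ℕ) / r + 1 := fun l => by
        rw [← hπ, multiperm, ← hab l]
        exact congrFun hσ (a l)
      intro i hi j hj hij
      simp only [Finset.coe_image, Finset.coe_univ, Set.image_univ, Set.mem_range] at hi hj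
      obtain ⟨i, rfl⟩ := hi
      obtain ⟨j, rfl⟩ := hj
      rw [key, key]
      have h1 := ha.monotone (hb.le_iff_le.1 hij)
      exact Nat.succ_le_succ (Nat.div_le_div_right h1)
  · rintro ⟨hreg, h⟩
    obtain ⟨s, hs, hmono, -⟩ := (le_insertWord_iff (hreg.mem_Icc hrn) _ _).1 h
    obtain ⟨π, rfl, hπ⟩ := hreg.exists_multiperm_eq hr
    refine ⟨⟨π, rfl⟩, ulamDist_le_iff.2 ⟨1, π, rfl, rfl, ?_⟩⟩
    have hlcs : n - t ≤ lcsLength (fun i => ((1 : Equiv.Perm (Fin n)) i : ℕ))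
        (fun i => (π i : ℕ)) := by
      refine le_lcsLength_iff.2 ⟨s.card, hs, fun l => π (s.orderEmbOfFin rfl l),
        s.orderEmbOfFin rfl, fun i j hij => ?_, (s.orderEmbOfFin rfl).strictMono, fun l => rfl⟩
      have hij' := (s.orderEmbOfFin rfl).strictMono hij
      exact hπ _ _ hij' (hmono (s.orderEmbOfFin_mem rfl i) (s.orderEmbOfFin_mem rfl j) hij'.le)
    unfold permUlamDist
    omega

/-! ### Counting -/

/-- The regular words whose insertion tableau has shape `a` correspond to the pairs of a
semistandard tableau with regular content and a standard tableau, both of shape `a`. -/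
theorem card_isRegular_shape (hr : r ∣ n) {a : ℕ →₀ ℕ} (ha : a.degree = n) :
    Nat.card {y : Fin n → ℕ // IsRegular r y ∧ insertWord y (n / r) = a} =
      Nat.card (chains n r (n / r) a) * Nat.card (chains n 1 n a) := by
  rw [← Nat.card_prod]
  have e : ∀ c : chains n r (n / r) a,
      {w : Fin n → ℕ // (∀ i, w i ∈ Set.Icc 1 (n / r)) ∧ insertWord w = c.1} ≃ chains n 1 n a :=
    fun c => Classical.choice (by
      have := nonempty_equiv_chains (n := n) c.2.1 (by rw [c.2.2.2, ha])
      rwa [c.2.2.2] at this)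
  refine Nat.card_congr (Equiv.trans ?_
    ((Equiv.sigmaCongrRight e).trans (Equiv.sigmaEquivProd _ _)))
  refine ⟨fun y => ⟨⟨insertWord y.1, isChain_insertWord (y.2.1.mem_Icc hr), fun v => ?_, y.2.2⟩,
    y.1, y.2.1.mem_Icc hr, rfl⟩, fun p => ⟨p.2.1, fun v => ?_, ?_⟩, fun y => rfl, ?_⟩
  · rw [degree_insertWord, y.2.1 v]
  · rw [← degree_insertWord, p.2.2.2, p.1.2.2.1]
  · rw [p.2.2.2, p.1.2.2.2]
  · rintro ⟨⟨c, hc⟩, w, hw, hwc⟩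
    obtain rfl : insertWord w = c := hwc
    rfl

theorem ncard_sphere_one (hr : 0 < r) (hrn : r ∣ n) (t : ℕ) :
    (sphere r (multiperm r (1 : Equiv.Perm (Fin n))) t).ncard =
      ∑ p ∈ partitionsWithFirstGE n (n - t), numSYT p * numRegularTableaux r p := by
  have hfin : Finite {y : Fin n → ℕ // IsRegular r y} := by
    refine Set.Finite.subset (Set.finite_range (multiperm (n := n) r)) fun y hy => ?_
    obtain ⟨π, hπ, -⟩ := IsRegular.exists_multiperm_eq hr hy
    exact ⟨π, hπ⟩
  have hfin' : ∀ a, Finite {y : Fin n → ℕ // IsRegular r y ∧ insertWord y (n / r) = a} := fun a =>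
    Finite.of_injective (fun y => (⟨y.1, y.2.1⟩ : {y : Fin n → ℕ // IsRegular r y}))
      fun y z h => Subtype.ext (Subtype.mk.inj h)
  have hdeg : ∀ p : n.Partition, (rowShape (diagram p)).degree = n := fun p => by
    rw [degree_rowShape, card_diagram]
  let f : (Σ p : partitionsWithFirstGE n (n - t),
      {y : Fin n → ℕ // IsRegular r y ∧ insertWord y (n / r) = rowShape (diagram p.1)}) →
      sphere r (multiperm r (1 : Equiv.Perm (Fin n))) t := fun q =>
    ⟨q.2.1, (mem_sphere_one_iff hr hrn).2 ⟨q.2.2.1, by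
      rw [q.2.2.2, ← sup_parts]
      exact (Finset.mem_filter.1 q.1.2).2⟩⟩
  have hf : Function.Bijective f := by
    constructor
    · rintro ⟨p, y, hy⟩ ⟨q, z, hz⟩ h
      obtain rfl : y = z := congrArg Subtype.val h
      obtain rfl : p = q :=
        Subtype.ext (diagram_injective (rowShape_injective (hy.2.symm.trans hz.2)))
      rfl
    · rintro ⟨y, hy⟩
      obtain ⟨hreg, hle⟩ := (mem_sphere_one_iff hr hrn).1 hy
      have hc := isChain_insertWord (hreg.mem_Icc hrn)
      obtain ⟨μ, hμ⟩ := exists_rowShape_eq (hc.anti (n / r))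
      obtain ⟨p, rfl⟩ : ∃ p : n.Partition, diagram p = μ := exists_diagram_eq <| by
        rw [← degree_rowShape, hμ, degree_insertWord, hreg, Nat.div_mul_cancel hrn, min_self]
      refine ⟨⟨⟨p, Finset.mem_filter.2 ⟨Finset.mem_univ p, ?_⟩⟩, y, hreg, hμ.symm⟩, rfl⟩
      rwa [sup_parts, hμ]
  rw [← Nat.card_coe_set_eq, ← Nat.card_congr (Equiv.ofBijective f hf), Nat.card_sigma]
  rw [← Finset.sum_coe_sort (partitionsWithFirstGE n (n - t))
    fun p => numSYT p * numRegularTableaux r p]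
  refine Finset.sum_congr rfl fun p _ => ?_
  rw [card_isRegular_shape hrn (hdeg p), numSYT_eq_numRegularTableaux, numRegularTableaux_eq hrn,
    numRegularTableaux_eq (one_dvd n), Nat.div_one, mul_comm]

/-! ### Spheres of permutations -/

theorem multiperm_one_injective : Function.Injective (multiperm (n := n) 1) := fun σ π h => by
  ext i
  simpa [multiperm] using congrFun h i

theorem sphere_one_eq_image (σ : Equiv.Perm (Fin n)) (t : ℕ) :
    sphere 1 (multiperm 1 σ) t = multiperm 1 '' {π | permUlamDist σ π ≤ t} := by
  ext y
  constructor
  · rintro ⟨⟨π, rfl⟩, h⟩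
    obtain ⟨σ', π', h1, h2, h3⟩ := ulamDist_le_iff.1 h
    rw [multiperm_one_injective h1, multiperm_one_injective h2] at h3
    exact ⟨π, h3, rfl⟩
  · rintro ⟨π, h, rfl⟩
    exact ⟨⟨π, rfl⟩, ulamDist_le_iff.2 ⟨σ, π, rfl, rfl, h⟩⟩

/-- Renaming the values does not change common subsequences. -/
theorem permUlamDist_mul_left (τ σ π : Equiv.Perm (Fin n)) :
    permUlamDist (τ * σ) (τ * π) = permUlamDist σ π := by
  simp [permUlamDist, lcsLength, Fin.val_inj]

theorem ncard_sphere_eq_ncard_sphere_one (σ : Equiv.Perm (Fin n)) (t : ℕ) :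
    (sphere 1 (multiperm 1 σ) t).ncard =
      (sphere 1 (multiperm 1 (1 : Equiv.Perm (Fin n))) t).ncard := by
  have h : {π | permUlamDist σ π ≤ t} = (σ * ·) '' {π | permUlamDist 1 π ≤ t} := by
    ext π
    constructor
    · intro h
      refine ⟨σ⁻¹ * π, ?_, mul_inv_cancel_left σ π⟩
      have := permUlamDist_mul_left σ 1 (σ⁻¹ * π)
      rw [mul_one, mul_inv_cancel_left] at this
      exact this.symm.trans_le h
    · rintro ⟨π, h, rfl⟩
      have := permUlamDist_mul_left σ 1 π
      rw [mul_one] at this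
      exact this.trans_le h
  rw [sphere_one_eq_image, sphere_one_eq_image,
    Set.ncard_image_of_injective _ multiperm_one_injective,
    Set.ncard_image_of_injective _ multiperm_one_injective, h,
    Set.ncard_image_of_injective _ (mul_right_injective σ)]

end UlamSphere

theorem theorem1 (n : ℕ) (hn : 0 < n) :
    (∀ r t : ℕ, 0 < r → r ∣ n → t ≤ n - r →
      (UlamSphere.sphere r (UlamSphere.multiperm r (1 : Equiv.Perm (Fin n))) t).ncard =
        ∑ p ∈ UlamSphere.partitionsWithFirstGE n (n - t),
          UlamSphere.numSYT p * UlamSphere.numRegularTableaux r p) ∧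
    (∀ (σ : Equiv.Perm (Fin n)) (t : ℕ), t ≤ n - 1 →
      (UlamSphere.sphere 1 (UlamSphere.multiperm 1 σ) t).ncard =
        ∑ p ∈ UlamSphere.partitionsWithFirstGE n (n - t), UlamSphere.numSYT p ^ 2) := by
  refine ⟨fun r t hr hrn _ => UlamSphere.ncard_sphere_one hr hrn t, fun σ t _ => ?_⟩
  rw [UlamSphere.ncard_sphere_eq_ncard_sphere_one,
    UlamSphere.ncard_sphere_one one_pos (one_dvd n)]
  refine Finset.sum_congr rfl fun p _ => ?_
  rw [← UlamSphere.numSYT_eq_numRegularTableaux, sq]
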